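/- Let $V=\bigoplus_{k\ge 0}V_k$ be a vertex operator algebra over $\mathbb{C}$ with $V_0=\mathbb{C}\mathbf{1}$, mutually local vertex operators $Y(a,z)=\sum_{n\in\mathbb{Z}}a_nz^{-n-1}$, and conformal vector $\omega\in V_2$, where $Y(\omega,z)=\sum_n L_nz^{-n-2}$. Let $\langle\,,\rangle$ be a Li–Zamolodchikov metric on $V$, that is, a symmetric nondegenerate bilinear form with $\langle\mathbf{1},\mathbf{1}\rangle=1$ and $$\langle Y(e^{zL_1}(-z^{-2})^{L_0}c,z^{-1})a,b\rangle=\langle a,Y(c,z)b\rangle\qquad(a,b,c\in V).$$ Suppose that $d_1=\dim V_1$ is finite, let $\{u_\alpha\}$ be a basis of $V_1$ and $\{u^\alpha\}\subset V_1$ the dual basis, $\langle u^\alpha,u_\beta\rangle=\delta^\alpha_\beta$. Then $V_1$ is closed under $[a,b]=a_0b$. For $a,b\in V_1$ put $K(a,b)=\mathrm{Tr}_{V_1}(a_0b_0)$ (the Killing form of $V_1$) and $$F(a,b;x,y)=\sum_\alpha\langle a,Y(u^\alpha,x)Y(u_\alpha,y)b\rangle=\sum_{m,n\in\mathbb{Z}}\sum_\alpha\langle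 a,u^\alpha_m u_{\alpha,n}b\rangle x^{-m-1}y^{-n-1},$$ where $u_{\alpha,n}$ is the $n$-th mode of $u_\alpha$. Then, for all $a,b\in V_1$, $$F(a,b;x,y)=\frac{G(a,b;x,y)}{x^2y^2(x-y)^2},$$ where $$G(a,b;x,y)=-\left[d_1x^2y^2+2xy(x-y)^2+(x-y)^4\right]\langle a,b\rangle+xy(x-y)^2K(a,b).$$ This holds as an identity in the field $\mathbb{C}((x))((y))$ of formal series (the expansion of the rational function in the region $|x|>|y|$), and for complex $x,y$ with $|x|>|y|>0$ the double series $F(a,b;x,y)$ converges absolutely to the rational function. -/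

import Mathlib

noncomputable section

/-- A vertex operator algebra over `ℂ` on the vector space `V`. The vertex operators
`Y(a, z) = ∑ aₙ z^(-n-1)` are Mathlib's `VertexOperator`s: for every `b` the series `Y(a, z) b` is
a Laurent series in `z` with coefficients in `V`. -/
structure VertexOperatorAlgebra (V : Type*) [AddCommGroup V] [Module ℂ V] where
  /-- the state-field correspondence `a ↦ Y(a, z)` -/
  Y : V →ₗ[ℂ] VertexOperator ℂ V
  /-- the vacuum vector -/
  vac : V
  /-- the conformal vector -/
  conformal : V
  /-- the central charge -/
  centralCharge : ℂ
  /-- the space `V_k` of vectors of conformal weight `k` -/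
  weight : ℕ → Submodule ℂ V
  isInternal : DirectSum.IsInternal weight
  vac_ne_zero : vac ≠ 0
  weight_zero : weight 0 = Submodule.span ℂ {vac}
  /-- `Y(𝟏, z) = id` -/
  vac_mode : ∀ (n : ℤ) (b : V), VertexOperator.ncoeff (Y vac) n b = if n = -1 then b else 0
  /-- creation property: `Y(a, z)𝟏` has no singular terms -/
  mode_vac_of_nonneg : ∀ (a : V) (n : ℤ), 0 ≤ n → VertexOperator.ncoeff (Y a) n vac = 0
  /-- creation property: `a₋₁𝟏 = a` -/
  mode_neg_one_vac : ∀ a : V, VertexOperator.ncoeff (Y a) (-1) vac = a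
  /-- mutual locality, `(x - y)^N [Y(a, x), Y(b, y)] = 0` for some `N`; this is the vanishing of the
  coefficient of `x^(-m-1) y^(-n-1)` for all `m` and `n` -/
  locality : ∀ a b : V, ∃ N : ℕ, ∀ m n : ℤ,
    ∑ i ∈ Finset.range (N + 1), ((-1 : ℂ) ^ i * (N.choose i : ℂ)) •
      (VertexOperator.ncoeff (Y a) (m + N - i) * VertexOperator.ncoeff (Y b) (n + i)
        - VertexOperator.ncoeff (Y b) (n + i) * VertexOperator.ncoeff (Y a) (m + N - i)) = 0
  conformal_mem : conformal ∈ weight 2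
  /-- the operators `Lₙ = ωₙ₊₁` satisfy the Virasoro algebra -/
  virasoro : ∀ m n : ℤ,
    VertexOperator.ncoeff (Y conformal) (m + 1) * VertexOperator.ncoeff (Y conformal) (n + 1)
      - VertexOperator.ncoeff (Y conformal) (n + 1) * VertexOperator.ncoeff (Y conformal) (m + 1)
    = ((m : ℂ) - n) • VertexOperator.ncoeff (Y conformal) (m + n + 1)
      + (if m + n = 0 then centralCharge / 12 * ((m : ℂ) ^ 3 - m) else 0) • (1 : Module.End ℂ V)
  /-- `L₀ = ω₁` is the grading operator -/
  L_zero : ∀ (k : ℕ), ∀ a ∈ weight k, VertexOperator.ncoeff (Y conformal) 1 a = (k : ℂ) • a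
  /-- `Y(L₋₁ a, z) = ∂Y(a, z)`, where `L₋₁ = ω₀` -/
  L_neg_one : ∀ (a : V) (n : ℤ),
    VertexOperator.ncoeff (Y (VertexOperator.ncoeff (Y conformal) 0 a)) n
      = (-(n : ℂ)) • VertexOperator.ncoeff (Y a) (n - 1)

namespace VertexOperatorAlgebra

variable {V : Type*} [AddCommGroup V] [Module ℂ V] (W : VertexOperatorAlgebra V)

/-- The mode `aₙ`, the coefficient of `z^(-n-1)` in `Y(a, z)`. -/
def mode (a : V) (n : ℤ) : Module.End ℂ V := VertexOperator.ncoeff (W.Y a) n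

/-- The Virasoro operator `Lₙ`. -/
def L (n : ℤ) : Module.End ℂ V := W.mode W.conformal (n + 1)

/-- `B` is a Li-Zamolodchikov metric: a symmetric, nondegenerate bilinear form with
`⟨𝟏, 𝟏⟩ = 1` and `⟨Y(e^(z L₁) (-z⁻²)^(L₀) c, z⁻¹) a, b⟩ = ⟨a, Y(c, z) b⟩`. -/
structure IsLiZMetric (B : LinearMap.BilinForm ℂ V) : Prop where
  symm : ∀ a b : V, B a b = B b a
  nondegenerate : B.Nondegenerate
  vac_vac : B W.vac W.vac = 1
  /-- The coefficient of `z^(-m-1)` of the invariance identity, for `c` of weight `k`: here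
  `(-z⁻²)^(L₀) c = (-1)^k z^(-2k) c`, and `L₁^i c = 0` for `i > k`. -/
  invariant : ∀ (k : ℕ), ∀ c ∈ W.weight k, ∀ (a b : V) (m : ℤ),
    B a (W.mode c m b) = (-1) ^ k * ∑ i ∈ Finset.range (k + 1),
      ((i.factorial : ℂ)⁻¹ * B (W.mode ((W.L 1 ^ i) c) (2 * k - i - m - 2) a) b)

/-- The weight one space is closed under `[a, b] = a₀ b`. -/
def WeightOneClosed : Prop := ∀ a ∈ W.weight 1, ∀ b ∈ W.weight 1, W.mode a 0 b ∈ W.weight 1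

variable {W} in
/-- The zero mode `a₀` of `a ∈ V_1` acting on `V_1`, i.e. `b ↦ [a, b]`. -/
def zeroMode (h : W.WeightOneClosed) (a : W.weight 1) : Module.End ℂ (W.weight 1) :=
  (W.mode (a : V) 0).restrict (h a a.2)

variable {W} in
/-- The Killing form `K(a, b) = Tr_{V_1}(a₀ b₀)`. -/
def killing (h : W.WeightOneClosed) (a b : W.weight 1) : ℂ :=
  LinearMap.trace ℂ (W.weight 1) (zeroMode h a * zeroMode h b)

/-- The Laurent series `⟨a, Y(c, x) v⟩ ∈ ℂ((x))`, linear in `v`. -/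
def matrixCoeff (B : LinearMap.BilinForm ℂ V) (a c : V) : V →ₗ[ℂ] LaurentSeries ℂ where
  toFun v := ((HahnModule.of ℂ).symm (W.Y c v)).map (B a)
  map_add' v w := by ext n; simp
  map_smul' r v := by
    ext n
    change B a (((HahnModule.of ℂ).symm (W.Y c (r • v))).coeff n)
      = r • B a (((HahnModule.of ℂ).symm (W.Y c v)).coeff n)
    rw [map_smul]
    exact map_smul (B a) r _

/-- The series `⟨a, Y(c, x) Y(d, y) b⟩`, as an element of the field `ℂ((x))((y))` of Laurent series
in `y` whose coefficients are Laurent series in `x`. -/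
def correlation (B : LinearMap.BilinForm ℂ V) (a c d b : V) : LaurentSeries (LaurentSeries ℂ) :=
  ((HahnModule.of ℂ).symm (W.Y d b)).map (W.matrixCoeff B a c)

end VertexOperatorAlgebra

/-- The variable `x` of `ℂ((x))((y))`. -/
def laurentX : LaurentSeries (LaurentSeries ℂ) := HahnSeries.C (HahnSeries.single (1 : ℤ) (1 : ℂ))

/-- The variable `y` of `ℂ((x))((y))`. -/
def laurentY : LaurentSeries (LaurentSeries ℂ) := HahnSeries.single (1 : ℤ) (1 : LaurentSeries ℂ)

/-- The complex number `r` as a constant of `ℂ((x))((y))`. -/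
def laurentConst (r : ℂ) : LaurentSeries (LaurentSeries ℂ) :=
  HahnSeries.C (HahnSeries.C r : LaurentSeries ℂ)

/-- The polynomial `-[d x²y² + 2xy(x-y)² + (x-y)⁴] s + xy(x-y)² κ`, evaluated in a commutative
ring. -/
def casimirNumerator {R : Type*} [CommRing R] (d : ℕ) (s κ x y : R) : R :=
  -((d : R) * x ^ 2 * y ^ 2 + 2 * x * y * (x - y) ^ 2 + (x - y) ^ 4) * s
    + x * y * (x - y) ^ 2 * κ

end

/-! ### Formal distributions and multiplication by differences of variables -/

noncomputable section

/-! By weight, `⟨a, u^α_m u_{α,n} b⟩` vanishes unless `m = k - 1`, `n = 1 - k` with `k ≥ 0`, so F is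
a single series in `x^(-k) y^(k-2)`. Its coefficients follow from the relations `[c_m, d_n] = (c_0
d)_{m+n} - m⟨c, d⟩δ_{m+n,0}` on V_1 and the adjunction `c_m* = -c_{-m}`. For `k = 0` the coefficient
is `-⟨a,b⟩`. For `k = 1` it is the Killing form, by moving the `u`'s past `a` and `b`. For `k ≥ 2`,
commuting the two modes gives `-(k-1) d_1 ⟨a,b⟩`; the term `(u^α_0 u_α)_0` drops out since a
symmetric tensor is contracted with a skew form, and the reversed product survives only at `k = 2`,
adding `-⟨a,b⟩` (`sum_apply_mode_mode`). Summing, `F = -⟨a,b⟩/y² + K/(xy) - ⟨a,b⟩/x² -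
d_1⟨a,b⟩/(x-y)²`, the partial fraction form of the claim.

The axioms contain locality but not the commutator formula, so Borcherds' formula is derived first
(`mode_lie_mode`): the difference of its two sides kills the vacuum and is local with respect to
every field, hence is zero. It is proved first for `c` satisfying `[T, c_m] = -m c_{m-1}`, where `T
= ω_0`. The Virasoro relations give this for `ω`; the formula for `ω` then gives it for every
vector. -/

/-- Multiplication by `x - y` on formal distributions in two variables, in terms of modes. -/
def shiftDiff (X : Type*) [AddCommGroup X] [Module ℂ X] : Module.End ℂ (ℤ → ℤ → X) where
  toFun f m n := f (m + 1) n - f m (n + 1)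
  map_add' f g := by ext; simp; abel
  map_smul' r f := by ext; simp [smul_sub]

/-- Multiplication by `x - w` on formal distributions in `x, y, w`. -/
def shiftDiffLeft (X : Type*) [AddCommGroup X] [Module ℂ X] : Module.End ℂ (ℤ → ℤ → ℤ → X) where
  toFun f m n p := f (m + 1) n p - f m n (p + 1)
  map_add' f g := by ext; simp; abel
  map_smul' r f := by ext; simp [smul_sub]

/-- Multiplication by `y - w` on formal distributions in `x, y, w`. -/
def shiftDiffRight (X : Type*) [AddCommGroup X] [Module ℂ X] : Module.End ℂ (ℤ → ℤ → ℤ → X) where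
  toFun f m n p := f m (n + 1) p - f m n (p + 1)
  map_add' f g := by ext; simp; abel
  map_smul' r f := by ext; simp [smul_sub]

section ShiftDiff

variable {X X' : Type*} [AddCommGroup X] [Module ℂ X] [AddCommGroup X'] [Module ℂ X']

theorem shiftDiff_apply (f : ℤ → ℤ → X) (m n : ℤ) :
    shiftDiff X f m n = f (m + 1) n - f m (n + 1) := rfl

theorem shiftDiff_pow_apply (N : ℕ) (f : ℤ → ℤ → X) (m n : ℤ) :
    (shiftDiff X ^ N) f m n = ∑ i ∈ Finset.range (N + 1),
      ((-1 : ℂ) ^ i * (N.choose i : ℂ)) • f (m + N - i) (n + i) := by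
  let S : Module.End ℂ (ℤ → ℤ → X) :=
    { toFun := fun f m n => f (m + 1) n
      map_add' := fun f g => rfl
      map_smul' := fun r f => rfl }
  let T : Module.End ℂ (ℤ → ℤ → X) :=
    { toFun := fun f m n => f m (n + 1)
      map_add' := fun f g => rfl
      map_smul' := fun r f => rfl }
  have hS : ∀ (k : ℕ) (f : ℤ → ℤ → X) (m n : ℤ), (S ^ k) f m n = f (m + k) n := by
    intro k
    induction k with
    | zero => intro f m n; simp
    | succ k ih =>
      intro f m n
      rw [pow_succ, Module.End.mul_apply, ih]
      change f (m + k + 1) n = _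
      push_cast; congr 1; ring
  have hT : ∀ (k : ℕ) (f : ℤ → ℤ → X) (m n : ℤ), (T ^ k) f m n = f m (n + k) := by
    intro k
    induction k with
    | zero => intro f m n; simp
    | succ k ih =>
      intro f m n
      rw [pow_succ, Module.End.mul_apply, ih]
      change f m (n + k + 1) = _
      push_cast; congr 1; ring
  have hST : Commute ((-1 : ℂ) • T) S := by
    apply Commute.smul_left
    rfl
  have h : shiftDiff X = (-1 : ℂ) • T + S := by
    ext f m n
    change f (m + 1) n - f m (n + 1) = (-1 : ℂ) • f m (n + 1) + f (m + 1) n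
    simp; abel
  rw [h, hST.add_pow]
  simp only [LinearMap.sum_apply, Finset.sum_apply]
  refine Finset.sum_congr rfl fun i hi => ?_
  have hi' : i ≤ N := by simpa [Nat.lt_succ_iff] using hi
  rw [(Nat.cast_commute (N.choose i) _).symm.eq, ← nsmul_eq_mul, smul_pow, smul_mul_assoc,
    ← Nat.cast_smul_eq_nsmul ℂ, smul_smul, LinearMap.smul_apply, Pi.smul_apply, Pi.smul_apply,
    Module.End.mul_apply, hT, hS, mul_comm]
  congr 2
  rw [Nat.cast_sub hi']; ring

theorem shiftDiff_pow_map (φ : X →ₗ[ℂ] X') (N : ℕ) (f : ℤ → ℤ → X) :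
    (shiftDiff X' ^ N) (fun m n => φ (f m n)) = fun m n => φ ((shiftDiff X ^ N) f m n) := by
  ext m n
  simp [shiftDiff_pow_apply]

theorem shiftDiff_pow_eq_zero_of_le {N M : ℕ} (h : N ≤ M) {f : ℤ → ℤ → X}
    (hf : (shiftDiff X ^ N) f = 0) : (shiftDiff X ^ M) f = 0 := by
  obtain ⟨k, rfl⟩ := Nat.exists_eq_add_of_le' h
  rw [pow_add, Module.End.mul_apply, hf, map_zero]

/-- A distribution killed by `x - y` is constant along antidiagonals, and each antidiagonal meets
the region `m ≥ 0`. Higher powers reduce to this by induction. -/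
theorem eq_zero_of_shiftDiff_pow_eq_zero (N : ℕ) {f : ℤ → ℤ → X}
    (hf : ∀ m n, 0 ≤ m → f m n = 0) (h : (shiftDiff X ^ N) f = 0) : f = 0 := by
  induction N generalizing f with
  | zero => simpa using h
  | succ N ih =>
    have h1 : shiftDiff X f = 0 := by
      refine ih (fun m n hm => ?_) (by rwa [pow_succ] at h)
      rw [shiftDiff_apply, hf _ _ hm, hf _ _ (by omega), sub_zero]
    have h2 : ∀ (k : ℕ) (m n : ℤ), f m n = f (m + k) (n - k) := by
      intro k
      induction k with
      | zero => simp
      | succ k ihk =>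
        intro m n
        have := congrFun (congrFun h1 (m + k)) (n - k - 1)
        rw [shiftDiff_apply, Pi.zero_apply, Pi.zero_apply, sub_eq_zero, sub_add_cancel] at this
        rw [ihk, ← this]
        push_cast
        congr 1 <;> ring
    ext m n
    rw [h2 m.natAbs, hf _ _ (by omega)]
    rfl

theorem shiftDiffLeft_pow_apply (N : ℕ) (f : ℤ → ℤ → ℤ → X) (m n p : ℤ) :
    (shiftDiffLeft X ^ N) f m n p = (shiftDiff X ^ N) (fun m p => f m n p) m p := by
  induction N generalizing f with
  | zero => simp
  | succ N ih => rw [pow_succ, pow_succ, Module.End.mul_apply, Module.End.mul_apply, ih]; rfl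

theorem shiftDiffRight_pow_apply (N : ℕ) (f : ℤ → ℤ → ℤ → X) (m : ℤ) :
    (shiftDiffRight X ^ N) f m = (shiftDiff X ^ N) (f m) := by
  induction N generalizing f with
  | zero => simp
  | succ N ih => rw [pow_succ, pow_succ, Module.End.mul_apply, Module.End.mul_apply, ih]; rfl

theorem commute_shiftDiffLeft_shiftDiffRight : Commute (shiftDiffLeft X) (shiftDiffRight X) := by
  ext f m n p
  simp only [Module.End.mul_apply]
  simp only [shiftDiffLeft, shiftDiffRight, LinearMap.coe_mk, AddHom.coe_mk]
  abel

theorem shiftDiffLeft_pow_apply_neg_one (M : ℕ) {f : ℤ → ℤ → ℤ → X}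
    (hf : ∀ m n p, 0 ≤ p → f m n p = 0) :
    (∀ m n p, 0 ≤ p → (shiftDiffLeft X ^ M) f m n p = 0) ∧
      ∀ m n, (shiftDiffLeft X ^ M) f m n (-1) = f (m + M) n (-1) := by
  induction M generalizing f with
  | zero => simpa using hf
  | succ M ih =>
    have h : ∀ m n p, 0 ≤ p → shiftDiffLeft X f m n p = 0 := by
      intro m n p hp
      change f (m + 1) n p - f m n (p + 1) = 0
      rw [hf _ _ _ hp, hf _ _ _ (by omega), sub_zero]
    obtain ⟨h1, h2⟩ := ih h
    refine ⟨by simpa [pow_succ] using h1, fun m n => ?_⟩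
    rw [pow_succ, Module.End.mul_apply, h2]
    change f (m + M + 1) n (-1) - f (m + M) n (-1 + 1) = _
    rw [hf _ _ (-1 + 1) (by norm_num), sub_zero]
    push_cast; congr 1; ring

theorem shiftDiffRight_pow_apply_neg_one (M : ℕ) {f : ℤ → ℤ → ℤ → X}
    (hf : ∀ m n p, 0 ≤ p → f m n p = 0) :
    (∀ m n p, 0 ≤ p → (shiftDiffRight X ^ M) f m n p = 0) ∧
      ∀ m n, (shiftDiffRight X ^ M) f m n (-1) = f m (n + M) (-1) := by
  induction M generalizing f with
  | zero => simpa using hf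
  | succ M ih =>
    have h : ∀ m n p, 0 ≤ p → shiftDiffRight X f m n p = 0 := by
      intro m n p hp
      change f m (n + 1) p - f m n (p + 1) = 0
      rw [hf _ _ _ hp, hf _ _ _ (by omega), sub_zero]
    obtain ⟨h1, h2⟩ := ih h
    refine ⟨by simpa [pow_succ] using h1, fun m n => ?_⟩
    rw [pow_succ, Module.End.mul_apply, h2]
    change f m (n + M + 1) (-1) - f m (n + M) (-1 + 1) = _
    rw [hf _ _ (-1 + 1) (by norm_num), sub_zero]
    push_cast; congr 1; ring

/-- Only nonnegative powers of `w` occur, so `w = 0` may be substituted: `(x-w)^M (y-w)^M f` becomes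
`x^M y^M f(x, y, 0)`, a mere shift of the modes with `p = -1`. -/
theorem apply_neg_one_eq_zero_of_shiftDiff (M : ℕ) {f : ℤ → ℤ → ℤ → X}
    (hf : ∀ m n p, 0 ≤ p → f m n p = 0)
    (h : (shiftDiffLeft X ^ M) ((shiftDiffRight X ^ M) f) = 0) (m n : ℤ) : f m n (-1) = 0 := by
  obtain ⟨h1, h2⟩ := shiftDiffRight_pow_apply_neg_one M hf
  have := (shiftDiffLeft_pow_apply_neg_one M h1).2 (m - M) (n - M)
  rw [h, h2] at this
  simpa using this.symm

/-- These are the coefficients of a field times the `j`-th divided derivative of the delta function.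
By Pascal's rule, each factor `x - y` lowers `j` by one. -/
theorem shiftDiff_choose_smul (e : ℤ → X) (j : ℕ) :
    (shiftDiff X ^ (j + 1)) (fun m n => ((Ring.choose m j : ℤ) : ℂ) • e (m + n - j)) = 0 := by
  induction j with
  | zero =>
    ext m n
    rw [zero_add, pow_one, shiftDiff_apply]
    simp only [Ring.choose_zero_right, Nat.cast_zero]
    rw [add_right_comm, add_assoc m n 1, sub_self]
    rfl
  | succ j ih =>
    rw [pow_succ, Module.End.mul_apply]
    convert ih using 2
    ext m n
    rw [shiftDiff_apply, Ring.choose_succ_succ, show m + 1 + n - ((j + 1 : ℕ) : ℤ) = m + n - j by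
      push_cast; ring, show m + (n + 1) - ((j + 1 : ℕ) : ℤ) = m + n - j by push_cast; ring,
      ← sub_smul]
    push_cast
    congr 1; ring

end ShiftDiff

/-! ### Modes and the uniqueness principle for local distributions -/

namespace VertexOperatorAlgebra

variable {V : Type*} [AddCommGroup V] [Module ℂ V] (W : VertexOperatorAlgebra V)

theorem exists_shiftDiff_lie_eq_zero (a b : V) :
    ∃ N : ℕ, (shiftDiff _ ^ N) (fun m n => ⁅W.mode a m, W.mode b n⁆) = 0 := by
  obtain ⟨N, hN⟩ := W.locality a b
  refine ⟨N, ?_⟩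
  ext1 m; ext1 n
  rw [shiftDiff_pow_apply]
  exact hN m n

theorem mode_add (a b : V) (n : ℤ) : W.mode (a + b) n = W.mode a n + W.mode b n := by
  simp [mode]

theorem mode_smul (r : ℂ) (a : V) (n : ℤ) : W.mode (r • a) n = r • W.mode a n := by
  simp [mode]

@[simp]
theorem mode_zero (n : ℤ) : W.mode 0 n = 0 := by
  simp [mode]

theorem mode_vac_apply_of_nonneg (a : V) {n : ℤ} (hn : 0 ≤ n) : W.mode a n W.vac = 0 :=
  W.mode_vac_of_nonneg a n hn

theorem mode_neg_one_apply_vac (a : V) : W.mode a (-1) W.vac = a := W.mode_neg_one_vac a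

theorem mode_vac (n : ℤ) : W.mode W.vac n = if n = -1 then 1 else 0 := by
  ext b
  have := W.vac_mode n b
  split_ifs at this ⊢ <;> exact this

theorem exists_mode_eq_zero (a b : V) : ∃ K : ℕ, ∀ n : ℤ, K ≤ n → W.mode a n b = 0 := by
  refine ⟨(-((HahnModule.of ℂ).symm (W.Y a b)).order).toNat, fun n hn => ?_⟩
  apply VertexOperator.ncoeff_eq_zero_of_lt_order
  omega

/-- The translation operator `T = L₋₁ = ω₀`. -/
theorem mode_translate (a : V) (n : ℤ) :
    W.mode (W.mode W.conformal 0 a) n = (-(n : ℂ)) • W.mode a (n - 1) := W.L_neg_one a n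

/-- A two-variable distribution of operators that is local with respect to `Y(b, z)` and
annihilates the vacuum annihilates `b`. -/
theorem apply_eq_zero_of_local (Q : ℤ → ℤ → Module.End ℂ V) (hQ : ∀ m n, Q m n W.vac = 0) (b : V)
    (M : ℕ) (h : (shiftDiffLeft _ ^ M) ((shiftDiffRight _ ^ M)
      (fun m n p => ⁅Q m n, W.mode b p⁆)) = 0) (m n : ℤ) : Q m n b = 0 := by
  -- `Y(b, w)𝟏` is regular with value `b` at `w = 0`. As `Q` kills the vacuum, `Q Y(b, w)𝟏 = [Q,
  -- Y(b, w)]𝟏`, to which locality applies.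
  have key := apply_neg_one_eq_zero_of_shiftDiff M (f := fun m n p => Q m n (W.mode b p W.vac))
    (fun m n p hp => by simp [W.mode_vac_apply_of_nonneg b hp]) ?_ m n
  · simpa [mode_neg_one_apply_vac] using key
  have e : (fun m n p => Q m n (W.mode b p W.vac))
      = fun m n p => LinearMap.applyₗ W.vac ⁅Q m n, W.mode b p⁆ := by
    ext m n p
    simp [Ring.lie_def, hQ]
  rw [e]
  ext m n p
  have h' := congrFun (congrFun (congrFun h m) n) p
  rw [shiftDiffLeft_pow_apply] at h' ⊢
  simp only [shiftDiffRight_pow_apply] at h' ⊢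
  have e2 : ∀ m, (shiftDiff V ^ M) (fun n p => LinearMap.applyₗ W.vac ⁅Q m n, W.mode b p⁆)
      = fun n p => LinearMap.applyₗ W.vac ((shiftDiff _ ^ M) (fun n p => ⁅Q m n, W.mode b p⁆) n p) :=
    fun m => shiftDiff_pow_map _ M _
  simp only [e2]
  rw [shiftDiff_pow_map (LinearMap.applyₗ W.vac) M
    (fun m p => (shiftDiff _ ^ M) (fun n p => ⁅Q m n, W.mode b p⁆) n p)]
  exact (congrArg (LinearMap.applyₗ W.vac) h').trans (map_zero _)

end VertexOperatorAlgebra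

/-! ### Borcherds' commutator formula -/

theorem shiftDiff_pow_translate {X : Type*} [AddCommGroup X] [Module ℂ X] (N : ℕ) (f : ℤ → ℤ → X)
    (t : ℤ) (h : (shiftDiff X ^ N) f = 0) : (shiftDiff X ^ N) (fun m n => f (m + t) n) = 0 := by
  ext m n
  have := congrFun (congrFun h (m + t)) n
  rw [shiftDiff_pow_apply] at this ⊢
  simp only [add_right_comm, add_sub_right_comm] at this ⊢
  exact this

namespace VertexOperatorAlgebra

variable {V : Type*} [AddCommGroup V] [Module ℂ V] (W : VertexOperatorAlgebra V)

/-- The commutator formula on the vacuum for `m ≥ 0`, where `c_m 𝟏 = 0`. The case `n = -1` is the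
creation property; lower `n` are reached through translation covariance. -/
theorem mode_apply_mode_vac {c : V}
    (hc : ∀ m : ℤ, ⁅W.mode W.conformal 0, W.mode c m⁆ = (-(m : ℂ)) • W.mode c (m - 1))
    (d : V) (m : ℕ) (n : ℤ) :
    W.mode c m (W.mode d n W.vac) = ∑ j ∈ Finset.range (m + 1),
      (m.choose j : ℂ) • W.mode (W.mode c j d) (m + n - j) W.vac := by
  have hpos : ∀ n : ℤ, 0 ≤ n → W.mode c m (W.mode d n W.vac) = ∑ j ∈ Finset.range (m + 1),
      (m.choose j : ℂ) • W.mode (W.mode c j d) (m + n - j) W.vac := by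
    intro n hn
    rw [W.mode_vac_apply_of_nonneg d hn, map_zero, Finset.sum_eq_zero]
    intro j hj
    rw [W.mode_vac_apply_of_nonneg _ (by have := Finset.mem_range.1 hj; omega), smul_zero]
  have hneg : ∀ (k : ℕ) (d : V), W.mode c m (W.mode d (-1 - k) W.vac)
      = ∑ j ∈ Finset.range (m + 1),
        (m.choose j : ℂ) • W.mode (W.mode c j d) (m + (-1 - k) - j) W.vac := by
    intro k
    induction k with
    | zero =>
      intro d
      rw [Finset.sum_range_succ, Finset.sum_eq_zero]
      · simp [mode_neg_one_apply_vac]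
      · intro j hj
        rw [W.mode_vac_apply_of_nonneg _ (by have := Finset.mem_range.1 hj; push_cast; omega),
          smul_zero]
    | succ k ih =>
      intro d
      -- Replacing `d` by `Td` lowers the mode, since `(Td)_n = -n d_{n-1}`; the resulting factor `k
      -- + 1` is cancelled at the end.
      have h1 := ih (W.mode W.conformal 0 d)
      have hcomm : ∀ j : ℤ, W.mode c j (W.mode W.conformal 0 d)
          = W.mode W.conformal 0 (W.mode c j d) + (j : ℂ) • W.mode c (j - 1) d := by
        intro j
        have := LinearMap.congr_fun (hc j) d
        simp only [Ring.lie_def, LinearMap.sub_apply, Module.End.mul_apply,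
          neg_smul] at this
        rw [LinearMap.neg_apply, LinearMap.smul_apply] at this
        rw [← sub_eq_iff_eq_add', ← neg_sub, this, neg_neg]
      simp only [hcomm, mode_translate, mode_add, mode_smul, LinearMap.add_apply,
        LinearMap.smul_apply, map_smul, smul_add, smul_smul] at h1
      rw [Finset.sum_add_distrib, Finset.sum_range_succ' (fun j =>
        ((m.choose j : ℂ) * ((j : ℤ) : ℂ)) • W.mode (W.mode c (j - 1) d) _ W.vac)] at h1
      simp only [Int.cast_natCast, Nat.cast_zero, Int.cast_zero, mul_zero, zero_smul, add_zero] at h1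
      have h2 : ∑ j ∈ Finset.range m, ((m.choose (j + 1) : ℂ) * ((j + 1 : ℕ) : ℂ)) •
          W.mode (W.mode c (((j + 1 : ℕ) : ℤ) - 1) d) (m + (-1 - k) - ((j + 1 : ℕ) : ℤ)) W.vac
          = ∑ j ∈ Finset.range (m + 1), ((m.choose j : ℂ) * ((m : ℂ) - j)) •
            W.mode (W.mode c j d) (m + (-1 - ((k + 1 : ℕ) : ℤ)) - j) W.vac := by
        rw [Finset.sum_range_succ]
        simp only [sub_self, mul_zero, zero_smul, add_zero]
        refine Finset.sum_congr rfl fun j hj => ?_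
        have hj' : j ≤ m := (Finset.mem_range.1 hj).le
        have h3 := Nat.choose_succ_right_eq m j
        have h4 : (m.choose (j + 1) : ℂ) * ((j + 1 : ℕ) : ℂ) = (m.choose j : ℂ) * ((m : ℂ) - j) := by
          rw [← Nat.cast_sub hj']; exact_mod_cast h3
        rw [h4]
        congr 3
        · congr 1; push_cast; ring_nf
        · push_cast; ring
      rw [h2, ← Finset.sum_add_distrib] at h1
      have h5 : ((k : ℂ) + 1) ≠ 0 := by exact_mod_cast Nat.succ_ne_zero k
      have h6 : ((k : ℂ) + 1) • W.mode c m (W.mode d (-1 - ((k + 1 : ℕ) : ℤ)) W.vac)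
          = ((k : ℂ) + 1) • ∑ j ∈ Finset.range (m + 1),
        (m.choose j : ℂ) • W.mode (W.mode c j d) (m + (-1 - ((k + 1 : ℕ) : ℤ)) - j) W.vac := by
        rw [Finset.smul_sum]
        convert h1 using 1
        · congr 1
          · push_cast; ring
          · congr 3; push_cast; ring
        · refine Finset.sum_congr rfl fun j hj => ?_
          rw [show (m : ℤ) + (-1 - k) - j - 1 = m + (-1 - ((k + 1 : ℕ) : ℤ)) - j by
            push_cast; ring, ← add_smul, smul_smul]
          congr 1; push_cast; ring
      exact smul_right_injective V h5 h6
  rcases le_or_gt 0 n with hn | hn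
  · exact hpos n hn
  · have := hneg (-1 - n).toNat d
    rwa [show -1 - ((-1 - n).toNat : ℤ) = n by omega] at this

theorem exists_shiftDiff_lie_eq_zero_of_finset (s : Finset V) (b : V) :
    ∃ N : ℕ, ∀ a ∈ s, (shiftDiff _ ^ N) (fun m n => ⁅W.mode a m, W.mode b n⁆) = 0 := by
  choose N hN using fun a => W.exists_shiftDiff_lie_eq_zero a b
  exact ⟨s.sup N, fun a ha => shiftDiff_pow_eq_zero_of_le (Finset.le_sup ha) (hN a)⟩

/-- The hypothesis on `c` keeps the argument free of circularity: translation covariance of all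
fields is itself a consequence of the case `c = ω`. -/
theorem mode_lie_mode_of_translate {c : V}
    (hc : ∀ m : ℤ, ⁅W.mode W.conformal 0, W.mode c m⁆ = (-(m : ℂ)) • W.mode c (m - 1))
    (d : V) (K : ℕ) (hK : ∀ j : ℕ, K ≤ j → W.mode c j d = 0) (m n : ℤ) :
    ⁅W.mode c m, W.mode d n⁆ = ∑ j ∈ Finset.range K,
      ((Ring.choose m j : ℤ) : ℂ) • W.mode (W.mode c j d) (m + n - j) := by
  set R : ℤ → ℤ → Module.End ℂ V := fun m n => ∑ j ∈ Finset.range K,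
      ((Ring.choose m j : ℤ) : ℂ) • W.mode (W.mode c j d) (m + n - j) with hR
  have hRz : ∀ N, K ≤ N → (shiftDiff _ ^ N) R = 0 := by
    intro N hN
    have : R = ∑ j ∈ Finset.range K, fun m n =>
        ((Ring.choose m j : ℤ) : ℂ) • W.mode (W.mode c j d) (m + n - j) := by
      ext1 m; ext1 n
      simp [hR, Finset.sum_apply]
    rw [this, map_sum]
    refine Finset.sum_eq_zero fun j hj => ?_
    exact shiftDiff_pow_eq_zero_of_le (by have := Finset.mem_range.1 hj; omega)
      (shiftDiff_choose_smul (W.mode (W.mode c j d)) j)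
  -- On the vacuum the difference has no terms with `m ≥ 0` and is killed by a power of `x - y`.
  have hvac : ∀ m n, (⁅W.mode c m, W.mode d n⁆ - R m n) W.vac = 0 := by
    obtain ⟨N, hN⟩ := W.exists_shiftDiff_lie_eq_zero c d
    have h0 : (shiftDiff _ ^ (max N K)) (fun m n => ⁅W.mode c m, W.mode d n⁆ - R m n) = 0 := by
      have : (fun m n => ⁅W.mode c m, W.mode d n⁆ - R m n)
        = (fun m n => ⁅W.mode c m, W.mode d n⁆) - R := rfl
      rw [this, map_sub, hRz _ (le_max_right _ _),
        shiftDiff_pow_eq_zero_of_le (le_max_left _ _) hN, sub_zero]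
    have h1 := shiftDiff_pow_map (LinearMap.applyₗ W.vac : Module.End ℂ V →ₗ[ℂ] V) (max N K)
      (fun m n => ⁅W.mode c m, W.mode d n⁆ - R m n)
    rw [h0] at h1
    have h2 := eq_zero_of_shiftDiff_pow_eq_zero (max N K) ?_
      (h1.trans (by ext m n; exact map_zero (LinearMap.applyₗ W.vac : Module.End ℂ V →ₗ[ℂ] V)))
    · intro m n
      exact congrFun (congrFun h2 m) n
    · intro m n hm
      lift m to ℕ using hm
      change (⁅W.mode c m, W.mode d n⁆ - R m n) W.vac = 0
      rw [LinearMap.sub_apply, sub_eq_zero, Ring.lie_def, LinearMap.sub_apply,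
        Module.End.mul_apply, Module.End.mul_apply,
        W.mode_vac_apply_of_nonneg c (Int.natCast_nonneg m), map_zero, sub_zero,
        W.mode_apply_mode_vac hc]
      simp only [hR, LinearMap.sum_apply, LinearMap.smul_apply, Ring.choose_natCast,
        Int.cast_natCast]
      rcases le_total K (m + 1) with h | h
      · symm
        apply Finset.sum_subset (Finset.range_mono h)
        intro j _ hj
        rw [hK j (by simpa using hj)]; simp
      · apply Finset.sum_subset (Finset.range_mono h)
        intro j _ hj
        rw [Nat.choose_eq_zero_of_lt (by simpa using hj)]; simp
  classical
  rw [← sub_eq_zero]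
  ext b
  obtain ⟨M, hM⟩ := W.exists_shiftDiff_lie_eq_zero_of_finset
    ({c, d} ∪ (Finset.range K).image (fun j : ℕ => W.mode c j d)) b
  refine W.apply_eq_zero_of_local (fun m n => ⁅W.mode c m, W.mode d n⁆ - R m n) hvac b M ?_ m n
  -- Jacobi identity: the first summand is killed by `(x-w)^M`, the other two by `(y-w)^M`.
  have hdecomp : (fun m n p => ⁅⁅W.mode c m, W.mode d n⁆ - R m n, W.mode b p⁆)
      = (fun m n p => ⁅⁅W.mode c m, W.mode b p⁆, W.mode d n⁆)
        + ((fun m n p => ⁅W.mode c m, ⁅W.mode d n, W.mode b p⁆⁆)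
        - fun m n p => ⁅R m n, W.mode b p⁆) := by
    ext1 m; ext1 n; ext1 p
    change _ = ⁅⁅W.mode c m, W.mode b p⁆, W.mode d n⁆ + (⁅W.mode c m, ⁅W.mode d n, W.mode b p⁆⁆
      - ⁅R m n, W.mode b p⁆)
    simp only [Ring.lie_def]
    noncomm_ring
  have hl : (shiftDiffLeft _ ^ M) (fun m n p => ⁅⁅W.mode c m, W.mode b p⁆, W.mode d n⁆) = 0 := by
    ext1 m; ext1 n; ext1 p
    rw [shiftDiffLeft_pow_apply]
    refine (congrFun (congrFun (shiftDiff_pow_map (LinearMap.mulRight ℂ (W.mode d n)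
      - LinearMap.mulLeft ℂ (W.mode d n)) M (fun m p => ⁅W.mode c m, W.mode b p⁆)) m) p).trans ?_
    rw [hM c (by simp)]
    exact map_zero _
  have hr1 : (shiftDiffRight _ ^ M) (fun m n p => ⁅W.mode c m, ⁅W.mode d n, W.mode b p⁆⁆) = 0 := by
    ext1 m
    rw [shiftDiffRight_pow_apply]
    refine (shiftDiff_pow_map (LinearMap.mulLeft ℂ (W.mode c m) - LinearMap.mulRight ℂ (W.mode c m))
      M (fun n p => ⁅W.mode d n, W.mode b p⁆)).trans ?_
    rw [hM d (by simp)]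
    ext1 n; ext1 p
    exact map_zero _
  have hr2 : (shiftDiffRight _ ^ M) (fun m n p => ⁅R m n, W.mode b p⁆) = 0 := by
    ext1 m
    rw [shiftDiffRight_pow_apply]
    have : (fun n p => ⁅R m n, W.mode b p⁆) = ∑ j ∈ Finset.range K,
        ((Ring.choose m j : ℤ) : ℂ) •
          fun n p => ⁅W.mode (W.mode c j d) (n + (m - j)), W.mode b p⁆ := by
      ext1 n; ext1 p
      simp only [hR, Finset.sum_apply, Pi.smul_apply, Ring.lie_def, Finset.sum_mul, Finset.mul_sum,
        smul_mul_assoc, mul_smul_comm, ← Finset.sum_sub_distrib, ← smul_sub]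
      refine Finset.sum_congr rfl fun j _ => ?_
      rw [show m + n - j = n + (m - j) by ring]
    rw [this, map_sum]
    refine Finset.sum_eq_zero fun j hj => ?_
    rw [map_smul]
    have hmem : W.mode c j d ∈ {c, d} ∪ (Finset.range K).image (fun j : ℕ => W.mode c j d) :=
      Finset.mem_union_right _ (Finset.mem_image_of_mem _ hj)
    rw [shiftDiff_pow_translate M (fun n p => ⁅W.mode (W.mode c j d) n, W.mode b p⁆) _
      (hM _ hmem), smul_zero]
  rw [hdecomp, map_add, map_sub, hr1, hr2, sub_zero, map_add, map_zero, add_zero,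
    ← Module.End.mul_apply, (commute_shiftDiffLeft_shiftDiffRight.pow_pow M M).eq,
    Module.End.mul_apply, hl, map_zero]

theorem conformal_lie_translate (m : ℤ) :
    ⁅W.mode W.conformal 0, W.mode W.conformal m⁆ = (-(m : ℂ)) • W.mode W.conformal (m - 1) := by
  have h := W.virasoro (-1) (m - 1)
  have e : (if -1 + (m - 1) = 0 then W.centralCharge / 12 * (((-1 : ℤ) : ℂ) ^ 3 - (-1 : ℤ)) else 0)
      = 0 := by
    split_ifs <;> norm_num
  rw [e, zero_smul, add_zero] at h
  rw [Ring.lie_def]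
  convert h using 2
  · simp [mode]
  · simp [mode]
  · push_cast; ring
  · rw [show (-1 : ℤ) + (m - 1) + 1 = m - 1 by ring]; rfl

/-- `[T, aₘ] = -m aₘ₋₁`. -/
theorem translate_lie_mode (a : V) (m : ℤ) :
    ⁅W.mode W.conformal 0, W.mode a m⁆ = (-(m : ℂ)) • W.mode a (m - 1) := by
  obtain ⟨K, hK⟩ := W.exists_mode_eq_zero W.conformal a
  -- At upper mode `0` only `j = 0` survives, leaving `(Ta)_m`; the bound `K + 1` ensures that this
  -- term is present.
  rw [W.mode_lie_mode_of_translate W.conformal_lie_translate a (K + 1)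
    (fun j hj => hK j (by exact_mod_cast (by omega : K ≤ j))), Finset.sum_range_succ',
    Finset.sum_eq_zero]
  · simp [mode_translate]
  · intro j _
    rw [Ring.choose_zero_succ]; simp

/-- Borcherds' commutator formula. -/
theorem mode_lie_mode (c d : V) (K : ℕ) (hK : ∀ j : ℕ, K ≤ j → W.mode c j d = 0) (m n : ℤ) :
    ⁅W.mode c m, W.mode d n⁆ = ∑ j ∈ Finset.range K,
      ((Ring.choose m j : ℤ) : ℂ) • W.mode (W.mode c j d) (m + n - j) :=
  W.mode_lie_mode_of_translate (W.translate_lie_mode c) d K hK m n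

/-! ### Conformal weights as eigenvalues of `L₀` -/

theorem L_zero_coe (x : DirectSum ℕ fun k => W.weight k) :
    W.mode W.conformal 1 (DirectSum.coeLinearMap W.weight x) = DirectSum.coeLinearMap W.weight
      (DirectSum.lmap (fun k : ℕ => (k : ℂ) • (LinearMap.id : W.weight k →ₗ[ℂ] W.weight k)) x) := by
  induction x using DirectSum.induction_on with
  | zero => simp
  | of k v =>
    rw [← DirectSum.lof_eq_of ℂ, DirectSum.lmap_lof, DirectSum.coeLinearMap_lof,
      DirectSum.coeLinearMap_lof]
    exact W.L_zero k v v.2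
  | add x y hx hy => simp only [map_add, hx, hy]

theorem exists_decomposition_of_L_zero {v : V} {μ : ℂ} (h : W.mode W.conformal 1 v = μ • v) :
    ∃ x : DirectSum ℕ fun k => W.weight k, DirectSum.coeLinearMap W.weight x = v ∧
      ∀ k : ℕ, (k : ℂ) ≠ μ → x k = 0 := by
  obtain ⟨x, rfl⟩ := W.isInternal.2 v
  refine ⟨x, rfl, fun k hk => ?_⟩
  have h1 : DirectSum.coeLinearMap W.weight
      (DirectSum.lmap (fun k : ℕ => (k : ℂ) • (LinearMap.id : W.weight k →ₗ[ℂ] W.weight k)) x)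
      = DirectSum.coeLinearMap W.weight (μ • x) := by
    rw [← L_zero_coe]
    exact h.trans (map_smul (DirectSum.coeLinearMap W.weight) μ x).symm
  have h2 := DFunLike.congr_fun (W.isInternal.1 h1) k
  rw [DirectSum.lmap_apply] at h2
  have h3 : ((k : ℂ) - μ) • x k = 0 := by
    rw [sub_smul, sub_eq_zero]
    exact h2
  exact (smul_eq_zero.1 h3).resolve_left (sub_ne_zero.2 hk)

theorem mem_weight_of_L_zero {v : V} (k : ℕ) (h : W.mode W.conformal 1 v = (k : ℂ) • v) :
    v ∈ W.weight k := by
  obtain ⟨x, rfl, hx⟩ := W.exists_decomposition_of_L_zero h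
  have : x = DirectSum.lof ℂ ℕ (fun k => W.weight k) k (x k) := by
    ext j : 1
    rcases eq_or_ne j k with rfl | hj
    · rw [DirectSum.lof_apply]
    · rw [hx j (by exact_mod_cast hj), DirectSum.lof_eq_of, DirectSum.of_eq_of_ne _ _ _ hj]
  rw [this, DirectSum.coeLinearMap_lof]
  exact (x k).2

theorem eq_zero_of_L_zero {v : V} {μ : ℂ} (h : W.mode W.conformal 1 v = μ • v)
    (hμ : ∀ k : ℕ, (k : ℂ) ≠ μ) : v = 0 := by
  obtain ⟨x, rfl, hx⟩ := W.exists_decomposition_of_L_zero h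
  have : x = 0 := by
    ext j : 1
    exact hx j (hμ j)
  rw [this, map_zero]

variable {W}

/-- The commutator formula for `ω_1` gives `[L₀, c_n] = (Tc)_{n+1} + (L₀c)_n = (k - n - 1) c_n`. -/
theorem L_zero_mode_apply {k l : ℕ} {c b : V} (hc : c ∈ W.weight k) (hb : b ∈ W.weight l) (n : ℤ) :
    W.mode W.conformal 1 (W.mode c n b) = (((k + l - n - 1 : ℤ)) : ℂ) • W.mode c n b := by
  obtain ⟨K, hK⟩ := W.exists_mode_eq_zero W.conformal c
  have h1 := W.mode_lie_mode W.conformal c (K + 2)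
    (fun j hj => hK j (by exact_mod_cast (by omega : K ≤ j))) 1 n
  rw [Finset.sum_range_succ', Finset.sum_range_succ', Finset.sum_eq_zero, zero_add] at h1
  · have h2 : W.mode W.conformal 1 c = (k : ℂ) • c := W.L_zero k c hc
    have h3 : W.mode W.conformal 1 b = (l : ℂ) • b := W.L_zero l b hb
    have h4 := LinearMap.congr_fun h1 b
    simp only [Nat.cast_zero, zero_add, Nat.cast_one, Ring.choose_one_right, Ring.choose_zero_right,
      mode_translate, h2, mode_smul, Ring.lie_def, LinearMap.sub_apply, Module.End.mul_apply, h3,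
      map_smul, LinearMap.add_apply, LinearMap.smul_apply, Int.cast_one, one_smul, sub_zero,
      add_sub_cancel_left] at h4
    rw [sub_eq_iff_eq_add] at h4
    rw [h4, ← add_smul, ← add_smul]
    congr 1; push_cast; ring
  · intro j _
    rw [show (1 : ℤ) = ((1 : ℕ) : ℤ) by rfl, Ring.choose_natCast,
      Nat.choose_eq_zero_of_lt (by omega)]
    simp

theorem mode_mem_weight {k l : ℕ} {c b : V} (hc : c ∈ W.weight k) (hb : b ∈ W.weight l) {n : ℤ}
    {j : ℕ} (hj : (j : ℤ) = k + l - n - 1) : W.mode c n b ∈ W.weight j := by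
  apply W.mem_weight_of_L_zero
  rw [L_zero_mode_apply hc hb, ← hj, Int.cast_natCast]

theorem mode_apply_eq_zero {k l : ℕ} {c b : V} (hc : c ∈ W.weight k) (hb : b ∈ W.weight l) {n : ℤ}
    (hn : (k : ℤ) + l - n - 1 < 0) : W.mode c n b = 0 := by
  apply W.eq_zero_of_L_zero (L_zero_mode_apply hc hb n)
  intro j hj
  have : (j : ℤ) = k + l - n - 1 := by exact_mod_cast hj
  omega

variable (W) in
theorem weightOneClosed : W.WeightOneClosed := fun _ ha _ hb => mode_mem_weight ha hb (by simp)

variable (W) in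
theorem conformal_mode_two : W.mode W.conformal 2 W.conformal = 0 := by
  have h := LinearMap.congr_fun (W.virasoro 1 (-2)) W.vac
  have h1 : VertexOperator.ncoeff (W.Y W.conformal) (-2 + 1) W.vac = W.conformal :=
    W.mode_neg_one_vac _
  simp only [LinearMap.sub_apply, Module.End.mul_apply, LinearMap.add_apply, LinearMap.smul_apply]
    at h
  rw [h1, W.mode_vac_of_nonneg _ _ (by norm_num), W.mode_vac_of_nonneg _ _ (by norm_num)] at h
  simpa [mode] using h

/-! ### The metric and the affine relations on V_1 -/

namespace IsLiZMetric

variable {B : LinearMap.BilinForm ℂ V} (hB : W.IsLiZMetric B)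
include hB

/-- Since `L₁ω = 0`, only the `i = 0` term of invariance remains, with sign `(-1)^2`. -/
theorem L_zero_symm (a b : V) : B a (W.mode W.conformal 1 b) = B (W.mode W.conformal 1 a) b := by
  have h := hB.invariant 2 W.conformal W.conformal_mem a b 1
  have h1 : W.L 1 W.conformal = 0 := W.conformal_mode_two
  rw [h, Finset.sum_range_succ, Finset.sum_range_succ, Finset.sum_range_one]
  simp [h1, pow_succ]

theorem eq_zero_of_weight_ne {k l : ℕ} {a b : V} (ha : a ∈ W.weight k) (hb : b ∈ W.weight l)
    (h : k ≠ l) : B a b = 0 := by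
  have h1 := hB.L_zero_symm a b
  rw [show W.mode W.conformal 1 b = (l : ℂ) • b from W.L_zero l b hb,
    show W.mode W.conformal 1 a = (k : ℂ) • a from W.L_zero k a ha] at h1
  simp only [map_smul, LinearMap.smul_apply, smul_eq_mul] at h1
  have h2 : ((l : ℂ) - k) * B a b = 0 := by linear_combination h1
  exact (mul_eq_zero.1 h2).resolve_left (sub_ne_zero.2 (by exact_mod_cast h.symm))

/-- `L₁a` is a multiple `r𝟏`; invariance for `⟨𝟏, a_0 𝟏⟩ = 0` isolates `r`. -/
theorem L_one_eq_zero {a : V} (ha : a ∈ W.weight 1) : W.L 1 a = 0 := by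
  have h1 : W.L 1 a ∈ W.weight 0 := mode_mem_weight W.conformal_mem ha (by norm_num)
  rw [W.weight_zero, Submodule.mem_span_singleton] at h1
  obtain ⟨r, hr⟩ := h1
  have h := hB.invariant 1 a ha W.vac W.vac 0
  rw [Finset.sum_range_succ, Finset.sum_range_one] at h
  simp only [pow_zero, pow_one, ← hr, mode_smul, mode_vac] at h
  norm_num [W.mode_vac_apply_of_nonneg, hB.vac_vac] at h
  rw [← hr, h, zero_smul]

theorem invariant_weight_one {c : V} (hc : c ∈ W.weight 1) (a b : V) (m : ℤ) :
    B a (W.mode c m b) = -B (W.mode c (-m) a) b := by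
  rw [hB.invariant 1 c hc a b m, Finset.sum_range_succ, Finset.sum_range_one]
  simp only [pow_zero, pow_one, hB.L_one_eq_zero hc]
  norm_num

/-- The scalar is read off from `⟨𝟏, c_1 d⟩ = -⟨c_{-1}𝟏, d⟩`. -/
theorem mode_one_weight_one {c d : V} (hc : c ∈ W.weight 1) (hd : d ∈ W.weight 1) :
    W.mode c 1 d = (-B c d) • W.vac := by
  have h1 : W.mode c 1 d ∈ W.weight 0 := mode_mem_weight hc hd (by norm_num)
  rw [W.weight_zero, Submodule.mem_span_singleton] at h1
  obtain ⟨r, hr⟩ := h1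
  have h := hB.invariant_weight_one hc W.vac d 1
  rw [← hr, mode_neg_one_apply_vac, map_smul, hB.vac_vac, smul_eq_mul, mul_one] at h
  rw [← hr, h]

/-- The affine Kac-Moody relations. -/
theorem lie_weight_one {c d : V} (hc : c ∈ W.weight 1) (hd : d ∈ W.weight 1) (m n : ℤ) :
    ⁅W.mode c m, W.mode d n⁆ = W.mode (W.mode c 0 d) (m + n)
      + (if m + n = 0 then -(m * B c d) else 0) • (1 : Module.End ℂ V) := by
  rw [W.mode_lie_mode c d 2
    (fun j hj => mode_apply_eq_zero hc hd (by push_cast; omega)), Finset.sum_range_succ,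
    Finset.sum_range_one]
  simp only [Nat.cast_zero, Nat.cast_one, Ring.choose_one_right, Ring.choose_zero_right,
    hB.mode_one_weight_one hc hd, mode_smul, mode_vac, Int.cast_one, one_smul, sub_zero]
  by_cases h : m + n = 0
  · simp [h, smul_smul]
  · have : ¬ m + n - 1 = -1 := by omega
    simp [h, this]

/-- Apply `[c_{-1}, d_0] = (c_0 d)_{-1}` to the vacuum. -/
theorem mode_zero_skew {c d : V} (hc : c ∈ W.weight 1) (hd : d ∈ W.weight 1) :
    W.mode c 0 d = -W.mode d 0 c := by
  have h := LinearMap.congr_fun (hB.lie_weight_one hc hd (-1) 0) W.vac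
  simp only [Ring.lie_def, LinearMap.sub_apply, Module.End.mul_apply,
    W.mode_vac_apply_of_nonneg d le_rfl, mode_neg_one_apply_vac, map_zero, zero_sub] at h
  rw [h]
  simp [mode_neg_one_apply_vac]

end IsLiZMetric

/-! ### Casimir contractions and the coefficients of F -/

section Casimir

variable {B : LinearMap.BilinForm ℂ V} {ι : Type*} [Fintype ι] [DecidableEq ι]
  {u : Module.Basis ι ℂ (W.weight 1)} {u' : ι → W.weight 1}

theorem dual_apply_eq_repr (hu : ∀ α β : ι, B (u' α : V) (u β : V) = if α = β then 1 else 0)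
    (v : W.weight 1) (α : ι) : B (u' α : V) (v : V) = u.repr v α := by
  have h : (v : V) = ∑ β, u.repr v β • (u β : V) := by
    simpa only [Submodule.coe_sum, Submodule.coe_smul] using congrArg Subtype.val (u.sum_repr v).symm
  rw [h, map_sum]
  simp [hu]

theorem sum_dual_smul (hu : ∀ α β : ι, B (u' α : V) (u β : V) = if α = β then 1 else 0)
    (v : W.weight 1) : ∑ α, B (u' α : V) (v : V) • (u α : V) = v := by
  simp only [dual_apply_eq_repr hu]
  simpa only [Submodule.coe_sum, Submodule.coe_smul] using congrArg Subtype.val (u.sum_repr v)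

theorem sum_dual_mul (hu : ∀ α β : ι, B (u' α : V) (u β : V) = if α = β then 1 else 0)
    (a b : W.weight 1) : ∑ α, B (u' α : V) (a : V) * B (u α : V) (b : V) = B (a : V) (b : V) := by
  conv_rhs => rw [← sum_dual_smul hu a]
  simp

/-- The Casimir tensor `∑ u^α ⊗ u_α` has the symmetric matrix `⟨u^β, u^α⟩` in the basis `u`. -/
theorem sum_skew_eq_zero (hu : ∀ α β : ι, B (u' α : V) (u β : V) = if α = β then 1 else 0)
    (hB : ∀ a b : V, B a b = B b a) (φ : V →ₗ[ℂ] V →ₗ[ℂ] ℂ)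
    (hφ : ∀ c ∈ W.weight 1, ∀ d ∈ W.weight 1, φ c d = -φ d c) :
    ∑ α, φ (u' α : V) (u α : V) = 0 := by
  have h1 : ∑ α, φ (u' α : V) (u α : V)
      = ∑ α, ∑ β, B (u' β : V) (u' α : V) * φ (u β : V) (u α : V) := by
    refine Finset.sum_congr rfl fun α _ => ?_
    conv_lhs => rw [← sum_dual_smul hu (u' α)]
    simp
  have h2 : ∑ α, ∑ β, B (u' β : V) (u' α : V) * φ (u β : V) (u α : V)
      = -∑ α, ∑ β, B (u' β : V) (u' α : V) * φ (u β : V) (u α : V) := by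
    conv_lhs => rw [Finset.sum_comm]
    simp only [← Finset.sum_neg_distrib]
    refine Finset.sum_congr rfl fun α _ => Finset.sum_congr rfl fun β _ => ?_
    rw [hφ _ (u α).2 _ (u β).2, hB]
    ring
  rw [h1]
  exact self_eq_neg.1 h2

theorem sum_dual_apply_eq_trace
    (hu : ∀ α β : ι, B (u' α : V) (u β : V) = if α = β then 1 else 0)
    (f : Module.End ℂ (W.weight 1)) :
    ∑ α, B (u' α : V) (f (u α) : V) = LinearMap.trace ℂ (W.weight 1) f := by
  rw [LinearMap.trace_eq_matrix_trace ℂ u, Matrix.trace]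
  refine Finset.sum_congr rfl fun α _ => ?_
  rw [dual_apply_eq_repr hu, Matrix.diag_apply, LinearMap.toMatrix_apply]

/-- The coefficient of `x^(-k) y^(k-2)` in the expansion of the genus zero two-point function. -/
def casimirCoeff {K : Type*} [Field K] (d : ℕ) (s κ : K) (k : ℕ) : K :=
  -- The linear term is kept for every `k`, so that it sums to a multiple of `(x-y)⁻²` plus one
  -- `y⁻²` term; the correction at `k = 0` cancels the latter and leaves the value `-s`.
  -(((k : K) - 1) * (d * s)) + (if k = 0 then -(s + d * s) else 0) + (if k = 1 then κ else 0)
    + (if k = 2 then -s else 0)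

namespace IsLiZMetric

variable (hB : W.IsLiZMetric B)
include hB

/-- `d_n b` has weight `1 - n`, forcing `n ≤ 1`, and orthogonality of distinct weights forces `m + n
= 0`. -/
theorem apply_mode_mode_eq_zero {a b c d : V} (ha : a ∈ W.weight 1) (hb : b ∈ W.weight 1)
    (hc : c ∈ W.weight 1) (hd : d ∈ W.weight 1) {m n : ℤ}
    (h : ∀ k : ℕ, ¬(m = k - 1 ∧ n = 1 - k)) : B a (W.mode c m (W.mode d n b)) = 0 := by
  rcases lt_or_ge 1 n with hn | hn
  · rw [mode_apply_eq_zero hd hb (by push_cast; omega), map_zero, map_zero]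
  · have h1 : W.mode d n b ∈ W.weight (1 - n).toNat := mode_mem_weight hd hb (by omega)
    have h2 := h (1 - n).toNat
    rcases lt_or_ge (1 - m - n) 0 with hm | hm
    · rw [mode_apply_eq_zero hc h1 (by push_cast; omega), map_zero]
    · have h3 : W.mode c m (W.mode d n b) ∈ W.weight (1 - m - n).toNat :=
        mode_mem_weight hc h1 (by omega)
      exact hB.eq_zero_of_weight_ne ha h3 (by omega)

theorem sum_apply_mode_mode (hu : ∀ α β : ι, B (u' α : V) (u β : V) = if α = β then 1 else 0)
    (h : W.WeightOneClosed) (a b : W.weight 1) (k : ℕ) :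
    ∑ α, B (a : V) (W.mode (u' α : V) (k - 1) (W.mode (u α : V) (1 - k) (b : V)))
      = casimirCoeff (Fintype.card ι) (B (a : V) (b : V)) (killing h a b) k := by
  match k with
  | 0 =>
    rw [← sum_dual_mul hu a b]
    simp only [casimirCoeff, Nat.cast_zero, zero_sub, sub_zero,
      hB.mode_one_weight_one (u _).2 b.2, map_smul, mode_neg_one_apply_vac, smul_eq_mul]
    simp only [neg_mul, Finset.sum_neg_distrib, hB.symm a]
    simp only [mul_comm (B (u _ : V) (b : V))]
    norm_num
  | 1 =>
    -- `⟨a, u'_0 u_0 b⟩ = -⟨u'_0 a, u_0 b⟩ = -⟨a_0 u', b_0 u⟩ = ⟨u', a_0 b_0 u⟩`, whose sum is a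
    -- trace.
    have e : ∀ α, B (a : V) (W.mode (u' α : V) 0 (W.mode (u α : V) 0 (b : V)))
        = B (u' α : V) ((zeroMode h a * zeroMode h b) (u α) : V) := by
      intro α
      rw [hB.invariant_weight_one (u' α).2, neg_zero, hB.mode_zero_skew (u' α).2 a.2,
        hB.mode_zero_skew (u α).2 b.2, map_neg, map_neg, LinearMap.neg_apply, neg_neg]
      have := hB.invariant_weight_one a.2 (u' α) (W.mode (b : V) 0 (u α)) 0
      rw [neg_zero] at this
      exact this.symm
    simp only [Nat.cast_one, sub_self, e, sum_dual_apply_eq_trace hu]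
    simp [casimirCoeff, killing]
  | j + 2 =>
    have hskew : ∑ α, B (a : V) (W.mode (W.mode (u' α : V) 0 (u α : V)) 0 (b : V)) = 0 := by
      let φ : V →ₗ[ℂ] V →ₗ[ℂ] ℂ := LinearMap.mk₂ ℂ
        (fun c d => B (a : V) (W.mode (W.mode c 0 d) 0 (b : V)))
        (by intros; simp [mode_add]) (by intros; simp [mode_smul])
        (by intros; simp [mode_add]) (by intros; simp [mode_smul])
      refine sum_skew_eq_zero hu hB.symm φ fun c hc d hd => ?_
      change B (a : V) (W.mode (W.mode c 0 d) 0 (b : V))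
        = -B (a : V) (W.mode (W.mode d 0 c) 0 (b : V))
      rw [hB.mode_zero_skew hc hd, ← neg_one_smul ℂ, mode_smul]
      simp
    -- The summands are the bracket, the central term, and the reversed product `-⟨u_{j+1} a,
    -- u'_{j+1} b⟩`. In the last, both vectors have weight `-j`, so it survives only for `j = 0`.
    have e : ∀ α, B (a : V) (W.mode (u' α : V) ((j + 2 : ℕ) - 1)
        (W.mode (u α : V) (1 - (j + 2 : ℕ)) (b : V)))
        = B (a : V) (W.mode (W.mode (u' α : V) 0 (u α : V)) 0 (b : V))
          + -((j + 1) * B (a : V) (b : V))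
          + if j = 0 then -(B (u' α : V) (b : V) * B (u α : V) (a : V)) else 0 := by
      intro α
      have h1 := LinearMap.congr_fun (hB.lie_weight_one (u' α).2 (u α).2
        ((j + 2 : ℕ) - 1) (1 - (j + 2 : ℕ))) (b : V)
      simp only [Ring.lie_def, LinearMap.sub_apply, Module.End.mul_apply, LinearMap.add_apply,
        LinearMap.smul_apply, Module.End.one_apply] at h1
      rw [sub_eq_iff_eq_add] at h1
      rw [h1, map_add, map_add, hB.invariant_weight_one (u α).2 a]
      rw [show (((j + 2 : ℕ) : ℤ) - 1 + (1 - ((j + 2 : ℕ) : ℤ))) = 0 by ring,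
        show -(1 - ((j + 2 : ℕ) : ℤ)) = j + 1 by push_cast; ring,
        show ((j + 2 : ℕ) : ℤ) - 1 = j + 1 by push_cast; ring]
      rw [if_pos rfl, map_smul, hu, if_pos rfl]
      congr 1
      · congr 1; simp; ring
      · split_ifs with hj
        · subst hj
          simp only [Nat.cast_zero, zero_add, hB.mode_one_weight_one (u' α).2 b.2,
            hB.mode_one_weight_one (u α).2 a.2]
          simp [hB.vac_vac, mul_comm]
        · rw [mode_apply_eq_zero (u' α).2 b.2 (by push_cast; omega), map_zero, neg_zero]
    simp only [e, Finset.sum_add_distrib, hskew]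
    simp only [casimirCoeff, Finset.sum_const, Finset.card_univ, zero_add]
    by_cases hj : j = 0
    · subst hj
      simp only [if_true, Finset.sum_neg_distrib, sum_dual_mul hu b a, hB.symm b a]
      simp
      ring
    · simp [hj]
      ring

end IsLiZMetric

end Casimir

end VertexOperatorAlgebra

/-! ### Convergence for `|x| > |y| > 0` -/

namespace VertexOperatorAlgebra

theorem hasSum_casimirCoeff (d : ℕ) (s κ : ℂ) {x y : ℂ} (hy : 0 < ‖y‖) (hxy : ‖y‖ < ‖x‖) :
    HasSum (fun k : ℕ => casimirCoeff d s κ k * x ^ (-((k : ℤ) - 1) - 1) * y ^ (-(1 - (k : ℤ)) - 1))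
      (casimirNumerator d s κ x y / (x ^ 2 * y ^ 2 * (x - y) ^ 2)) := by
  have hy0 : y ≠ 0 := norm_pos_iff.1 hy
  have hx0 : x ≠ 0 := norm_pos_iff.1 (hy.trans hxy)
  have hne : x - y ≠ 0 := sub_ne_zero.2 fun h => by simp [h] at hxy
  have hr : ‖y / x‖ < 1 := by
    rw [norm_div]
    exact (div_lt_one (hy.trans hxy)).2 hxy
  -- With `r = y/x`, the linear term of the coefficients contributes `∑ (k - 1) r^k`; the rest are
  -- three isolated terms.
  have h1 := (((hasSum_coe_mul_geometric_of_norm_lt_one hr).sub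
    (hasSum_geometric_of_norm_lt_one hr)).mul_left (-(d * s) / y ^ 2)).add
    (((hasSum_ite_eq 0 (-(s + d * s) / y ^ 2)).add (hasSum_ite_eq 1 (κ / (x * y)))).add
      (hasSum_ite_eq 2 (-s / x ^ 2)))
  convert h1 using 1
  · rfl
  · funext k
    have e1 : x ^ (-((k : ℤ) - 1) - 1) = (x ^ k)⁻¹ := by
      rw [show (-((k : ℤ) - 1) - 1) = -(k : ℤ) by ring, zpow_neg, zpow_natCast]
    have e2 : y ^ (-(1 - (k : ℤ)) - 1) = y ^ k / y ^ 2 := by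
      rw [show (-(1 - (k : ℤ)) - 1) = (k : ℤ) - (2 : ℕ) by push_cast; ring, zpow_sub₀ hy0,
        zpow_natCast, zpow_natCast]
    rw [e1, e2, casimirCoeff, div_pow]
    match k with
    | 0 => simp; field_simp; ring
    | 1 => simp; field_simp
    | 2 => norm_num; field_simp; ring
    | k + 3 => simp; field_simp
  · have e : 1 - y / x = (x - y) / x := by field_simp
    rw [e, casimirNumerator]
    field_simp
    ring

theorem natCast_sub_one_injective :
    Function.Injective fun k : ℕ => ((k : ℤ) - 1, 1 - (k : ℤ)) := by
  intro i j h
  simpa using congrArg Prod.fst h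

/-! ### Expansion of the rational function in a field of Laurent series -/

section Expansion

variable {K : Type*} [Field K] (x : K)

/-- The expansion of `(x - y)⁻¹` in nonnegative powers of `y`. -/
def geometricSeries : LaurentSeries K :=
  HahnSeries.ofSuppBddBelow (fun p => if 0 ≤ p then x ^ (-p - 1) else 0)
    (bddBelow_def.2 ⟨0, fun _ hp => not_lt.1 fun h => hp (if_neg h.not_ge)⟩)

/-- The expansion of `(x - y)⁻²` in nonnegative powers of `y`. -/
def geometricSeriesSq : LaurentSeries K :=
  HahnSeries.ofSuppBddBelow (fun p => if 0 ≤ p then x ^ (-p - 2) * ((p : K) + 1) else 0)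
    (bddBelow_def.2 ⟨0, fun _ hp => not_lt.1 fun h => hp (if_neg h.not_ge)⟩)

theorem coeff_C_sub_single_one_mul (f : LaurentSeries K) (p : ℤ) :
    ((HahnSeries.C x - HahnSeries.single (1 : ℤ) (1 : K)) * f).coeff p
      = x * f.coeff p - f.coeff (p - 1) := by
  have := HahnSeries.coeff_single_mul_add (r := (1 : K)) (x := f) (a := p - 1) (b := (1 : ℤ))
  rw [sub_add_cancel, one_mul] at this
  rw [sub_mul, HahnSeries.coeff_sub, this, HahnSeries.C_mul_eq_smul, HahnSeries.coeff_smul,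
    smul_eq_mul]

variable {x}

theorem C_sub_single_one_mul_geometricSeries (hx : x ≠ 0) :
    (HahnSeries.C x - HahnSeries.single (1 : ℤ) (1 : K)) * geometricSeries x = 1 := by
  ext p
  rw [coeff_C_sub_single_one_mul, HahnSeries.coeff_one]
  simp only [geometricSeries, HahnSeries.coeff_ofSuppBddBelow]
  rcases lt_trichotomy p 0 with hp | rfl | hp
  · rw [if_neg (by omega), if_neg (by omega), if_neg (by omega), mul_zero, sub_zero]
  · simp [hx]
  · rw [if_pos (by omega), if_pos (by omega), if_neg (by omega), ← zpow_one_add₀ hx,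
      show 1 + (-p - 1) = -(p - 1) - 1 by ring, sub_self]

theorem C_sub_single_one_mul_geometricSeriesSq (hx : x ≠ 0) :
    (HahnSeries.C x - HahnSeries.single (1 : ℤ) (1 : K)) * geometricSeriesSq x
      = geometricSeries x := by
  ext p
  rw [coeff_C_sub_single_one_mul]
  simp only [geometricSeries, geometricSeriesSq, HahnSeries.coeff_ofSuppBddBelow]
  rcases lt_trichotomy p 0 with hp | rfl | hp
  · rw [if_neg (by omega), if_neg (by omega), if_neg (by omega), mul_zero, sub_zero]
  · simp only [le_refl, if_true, neg_zero, zero_sub, Int.cast_zero, zero_add, mul_one,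
      Int.reduceNeg, Int.reduceLE, if_false, sub_zero]
    rw [← zpow_one_add₀ hx]
    rfl
  · rw [if_pos (by omega), if_pos (by omega), if_pos (by omega), ← mul_assoc, ← zpow_one_add₀ hx,
      show 1 + (-p - 2) = -p - 1 by ring, show -(p - 1) - 2 = -p - 1 by ring]
    push_cast; ring

/-- The double series with coefficients `casimirCoeff`. -/
def casimirSeries (x : K) (d : ℕ) (s κ : K) : LaurentSeries K :=
  HahnSeries.ofSuppBddBelow
    -- The exponent of `y` is `p = k - 2`, hence the index `k = p + 2`.
    (fun p => if -2 ≤ p then x ^ (-p - 2) * casimirCoeff d s κ (p + 2).toNat else 0)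
    (bddBelow_def.2 ⟨-2, fun _ hp => not_lt.1 fun h => hp (if_neg h.not_ge)⟩)

theorem casimirSeries_eq_add (d : ℕ) (s κ : K) :
    casimirSeries x d s κ = HahnSeries.single (-2) (-s) + HahnSeries.single (-1) (κ * x⁻¹)
      + HahnSeries.C (-s * x⁻¹ ^ 2) - HahnSeries.C (d * s) * geometricSeriesSq x := by
  ext p
  rw [HahnSeries.C_mul_eq_smul]
  simp only [casimirSeries, geometricSeriesSq, HahnSeries.coeff_add, HahnSeries.coeff_sub,
    HahnSeries.coeff_smul, HahnSeries.coeff_ofSuppBddBelow, HahnSeries.C_apply,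
    HahnSeries.coeff_single, smul_eq_mul]
  rcases lt_or_ge p (-2) with hp | hp
  · rw [if_neg (by omega), if_neg (by omega), if_neg (by omega), if_neg (by omega),
      if_neg (by omega)]
    simp
  · obtain ⟨k, rfl⟩ : ∃ k : ℕ, p = k - 2 := ⟨(p + 2).toNat, by omega⟩
    rw [if_pos hp, sub_add_cancel, Int.toNat_natCast]
    match k with
    | 0 => simp [casimirCoeff]
    | 1 => simp [casimirCoeff, mul_comm]
    | 2 =>
      have e : x ^ (-2 : ℤ) = x⁻¹ ^ 2 := by rw [zpow_neg, inv_pow]; norm_cast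
      simp [casimirCoeff, e]
      ring
    | k + 3 =>
      rw [if_neg (by omega), if_neg (by omega), if_neg (by omega), if_pos (by omega)]
      simp [casimirCoeff]
      ring

theorem casimirNumerator_div (d : ℕ) (s κ : K) {y : K} (hx : x ≠ 0) (hy : y ≠ 0)
    (hxy : x - y ≠ 0) :
    casimirNumerator d s κ x y / (x ^ 2 * y ^ 2 * (x - y) ^ 2)
      = -s * (y⁻¹) ^ 2 + κ * x⁻¹ * y⁻¹ + -s * (x⁻¹) ^ 2 - d * s * ((x - y)⁻¹) ^ 2 := by
  rw [casimirNumerator]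
  field_simp
  ring

/-- In the field `K((y))` the geometric series is the inverse of `x - y`, so both sides share one
partial fraction form. -/
theorem casimirSeries_eq_div (d : ℕ) (s κ : K) (hx : x ≠ 0) :
    casimirSeries x d s κ = casimirNumerator d (HahnSeries.C s) (HahnSeries.C κ) (HahnSeries.C x)
        (HahnSeries.single (1 : ℤ) (1 : K))
      / (HahnSeries.C x ^ 2 * HahnSeries.single (1 : ℤ) (1 : K) ^ 2
        * (HahnSeries.C x - HahnSeries.single (1 : ℤ) (1 : K)) ^ 2) := by
  have h1 := C_sub_single_one_mul_geometricSeries hx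
  have hX : (HahnSeries.C x : LaurentSeries K) * HahnSeries.C x⁻¹ = 1 := by
    rw [← map_mul, mul_inv_cancel₀ hx, map_one]
  have hY : HahnSeries.single (1 : ℤ) (1 : K) * HahnSeries.single (-1) 1 = 1 := by
    rw [HahnSeries.single_mul_single]
    simp
  have h2 : geometricSeriesSq x = geometricSeries x ^ 2 := by
    rw [← one_mul (geometricSeriesSq x), ← h1, mul_right_comm,
      C_sub_single_one_mul_geometricSeriesSq hx, pow_two]
  rw [casimirNumerator_div _ _ _ (left_ne_zero_of_mul_eq_one hX) (left_ne_zero_of_mul_eq_one hY)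
    (left_ne_zero_of_mul_eq_one h1), casimirSeries_eq_add, h2, ← eq_inv_of_mul_eq_one_right h1,
    ← eq_inv_of_mul_eq_one_right hX, ← eq_inv_of_mul_eq_one_right hY]
  congr 1
  · congr 1
    · congr 1
      · rw [pow_two, HahnSeries.single_mul_single, HahnSeries.C_apply, neg_mul,
          HahnSeries.single_mul_single]
        simp
      · rw [← map_mul, HahnSeries.C_apply, HahnSeries.single_mul_single]
        simp
    · simp
  · rw [map_mul, map_natCast]

theorem map_casimirCoeff {K' : Type*} [Field K'] (f : K →+* K') (d : ℕ) (s κ : K) (k : ℕ) :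
    f (casimirCoeff d s κ k) = casimirCoeff d (f s) (f κ) k := by
  simp [casimirCoeff, apply_ite f]

end Expansion

theorem coeff_coeff_casimirSeries (d : ℕ) (s κ : ℂ) (p q : ℤ) :
    ((casimirSeries (HahnSeries.single (1 : ℤ) (1 : ℂ) : LaurentSeries ℂ) d (HahnSeries.C s)
      (HahnSeries.C κ)).coeff p).coeff q
      = if -2 ≤ p ∧ q = -p - 2 then casimirCoeff d s κ (p + 2).toNat else 0 := by
  simp only [casimirSeries, HahnSeries.coeff_ofSuppBddBelow]
  by_cases hp : -2 ≤ p
  · rw [if_pos hp, ← map_casimirCoeff (HahnSeries.C : ℂ →+* LaurentSeries ℂ),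
      ← RatFunc.single_zpow, HahnSeries.C_apply, HahnSeries.single_mul_single,
      HahnSeries.coeff_single]
    simp [hp]
  · rw [if_neg hp, if_neg fun h => hp h.1, HahnSeries.coeff_zero]

end VertexOperatorAlgebra

/-! ### Assembly of the formal and analytic statements -/

open VertexOperatorAlgebra in
theorem mainTheorem11 {V : Type*} [AddCommGroup V] [Module ℂ V] (W : VertexOperatorAlgebra V)
    (B : LinearMap.BilinForm ℂ V) (hB : W.IsLiZMetric B)
    {ι : Type*} [Fintype ι] [DecidableEq ι]
    (u : Module.Basis ι ℂ (W.weight 1)) (u' : ι → W.weight 1)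
    (hu : ∀ α β : ι, B (u' α : V) (u β : V) = if α = β then 1 else 0) :
    ∃ h : W.WeightOneClosed, ∀ a b : W.weight 1,
      -- the identity of formal series, in the field `ℂ((x))((y))`
      (∑ α, W.correlation B (a : V) (u' α : V) (u α : V) (b : V)
        = casimirNumerator (Module.finrank ℂ (W.weight 1)) (laurentConst (B (a : V) (b : V)))
            (laurentConst (VertexOperatorAlgebra.killing h a b)) laurentX laurentY
          / (laurentX ^ 2 * laurentY ^ 2 * (laurentX - laurentY) ^ 2)) ∧
      -- the double series converges to the rational function for `|x| > |y| > 0`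
      (∀ x y : ℂ, 0 < ‖y‖ → ‖y‖ < ‖x‖ →
        HasSum (fun p : ℤ × ℤ =>
            (∑ α, B (a : V) (W.mode (u' α : V) p.1 (W.mode (u α : V) p.2 (b : V))))
              * x ^ (-p.1 - 1) * y ^ (-p.2 - 1))
          (casimirNumerator (Module.finrank ℂ (W.weight 1)) (B (a : V) (b : V))
              (VertexOperatorAlgebra.killing h a b) x y
            / (x ^ 2 * y ^ 2 * (x - y) ^ 2))) := by
  refine ⟨W.weightOneClosed, fun a b => ?_⟩
  rw [Module.finrank_eq_card_basis u]
  have hzero : ∀ m n : ℤ, (∀ k : ℕ, ¬(m = k - 1 ∧ n = 1 - k)) →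
      ∑ α, B (a : V) (W.mode (u' α : V) m (W.mode (u α : V) n (b : V))) = 0 := fun m n h =>
    Finset.sum_eq_zero fun α _ => hB.apply_mode_mode_eq_zero a.2 b.2 (u' α).2 (u α).2 h
  constructor
  · refine Eq.trans ?_ (casimirSeries_eq_div (x := (HahnSeries.single (1 : ℤ) (1 : ℂ) :
      LaurentSeries ℂ)) _ (HahnSeries.C (B (a : V) (b : V)))
      (HahnSeries.C (killing W.weightOneClosed a b)) (by simp))
    ext p q
    have hcoeff : ((∑ α, W.correlation B (a : V) (u' α : V) (u α : V) (b : V)).coeff p).coeff q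
        = ∑ α, B (a : V) (W.mode (u' α : V) (-q - 1) (W.mode (u α : V) (-p - 1) (b : V))) := by
      rw [HahnSeries.coeff_sum, HahnSeries.coeff_sum]
      refine Finset.sum_congr rfl fun α _ => ?_
      simp only [mode, VertexOperator.ncoeff_apply]
      rw [show -(-q - 1) - 1 = q by ring, show -(-p - 1) - 1 = p by ring]
      rfl
    rw [hcoeff]
    refine Eq.trans ?_ (coeff_coeff_casimirSeries _ _ _ p q).symm
    split_ifs with hp
    · obtain ⟨k, rfl⟩ : ∃ k : ℕ, p = k - 2 := ⟨(p + 2).toNat, by omega⟩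
      rw [sub_add_cancel, Int.toNat_natCast, ← hB.sum_apply_mode_mode hu W.weightOneClosed a b,
        hp.2, show -(-((k : ℤ) - 2) - 2) - 1 = k - 1 by ring,
        show -((k : ℤ) - 2) - 1 = 1 - k by ring]
    · exact hzero _ _ fun j hj => hp (by omega)
  · intro x y hy hxy
    -- The double series is supported on the pairs `(k - 1, 1 - k)`, so it reduces to a sum over
    -- `k`.
    rw [← natCast_sub_one_injective.hasSum_iff]
    · convert hasSum_casimirCoeff (Fintype.card ι) (B (a : V) (b : V))
        (killing W.weightOneClosed a b) hy hxy using 2 with k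
      rw [← hB.sum_apply_mode_mode hu W.weightOneClosed a b]
      rfl
    · rintro ⟨m, n⟩ h
      rw [hzero m n fun k hk => h ⟨k, by simp [hk.1, hk.2]⟩, zero_mul, zero_mul]

end
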